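/- Let $q>1$ be a prime power and let $\mathbb{F}_q$ be the field with $q$ elements. For subspaces $X,Y$ of $\mathbb{F}_q^v$ let $d_S(X,Y)=\dim(X+Y)-\dim(X\cap Y)$ be the subspace distance, and let $A_q(v,d;k)$ denote the maximum cardinality of a set $\mathcal{C}$ of $k$-dimensional subspaces of $\mathbb{F}_q^v$ such that $d_S(X,Y)\ge d$ for all distinct $X,Y\in\mathcal{C}$. Write $\genfrac{[}{]}{0pt}{}{r}{1}_q=\frac{q^r-1}{q-1}$ for the Gaussian binomial coefficient. Let $v=tk+r$ with integers $t\ge 2$, $k$ and $r\in\{1,\dots,k-1\}$. If $k>\genfrac{[}{]}{0pt}{}{r}{1}_q$, then $$A_q(v,2k;k)=\frac{q^v-q^{k+r}}{q^k-1}+1.$$ -/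

import Mathlib

/-- The Gaussian binomial coefficient with parameters `v`, `k` at `q`, as a rational number:
`((q^v - 1)(q^(v-1) - 1) ⋯ (q^(v-k+1) - 1)) / ((q^k - 1)(q^(k-1) - 1) ⋯ (q - 1))` if
`0 ≤ k ≤ v`, and `0` otherwise. -/
def gaussBinom (q v k : ℕ) : ℚ :=
  if k ≤ v then
    (∏ i ∈ Finset.range k, ((q : ℚ) ^ (v - i) - 1)) /
      ∏ i ∈ Finset.range k, ((q : ℚ) ^ (k - i) - 1)
  else 0

/-- The subspace distance `dim (X + Y) - dim (X ∩ Y)`. -/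
noncomputable def subspaceDist {F V : Type*} [Field F] [AddCommGroup V] [Module F V]
    (X Y : Submodule F V) : ℤ :=
  (Module.finrank F ↥(X ⊔ Y) : ℤ) - (Module.finrank F ↥(X ⊓ Y) : ℤ)

/-- `C` is a constant-dimension-`k` subspace code in `F^v` whose minimum subspace distance is at
least `d` (no condition on distances if `C` has at most one element). -/
def IsConstDimCode (F : Type*) [Field F] (v d k : ℕ) (C : Finset (Submodule F (Fin v → F))) :
    Prop :=
  (∀ X ∈ C, Module.finrank F ↥X = k) ∧
    ∀ X ∈ C, ∀ Y ∈ C, X ≠ Y → (d : ℤ) ≤ subspaceDist X Y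

/-- The maximum cardinality of a constant-dimension-`k` code in `F^v` with minimum subspace
distance at least `d`; written `A_q(v, d; k)` when `F` has `q` elements. -/
noncomputable def maxCodeSize (F : Type*) [Field F] (v d k : ℕ) : ℕ :=
  sSup {n : ℕ | ∃ C : Finset (Submodule F (Fin v → F)), IsConstDimCode F v d k C ∧ C.card = n}

/-- Over a finite field the supremum in `maxCodeSize` is an attained maximum. -/
theorem isGreatest_maxCodeSize (F : Type*) [Field F] [Finite F] (v d k : ℕ) :
    IsGreatest
      {n : ℕ | ∃ C : Finset (Submodule F (Fin v → F)), IsConstDimCode F v d k C ∧ C.card = n}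
      (maxCodeSize F v d k) := by
  have hfin : Finite (Submodule F (Fin v → F)) :=
    Finite.of_injective (fun S : Submodule F (Fin v → F) => (S : Set (Fin v → F)))
      SetLike.coe_injective
  have hb : BddAbove {n : ℕ | ∃ C : Finset (Submodule F (Fin v → F)),
      IsConstDimCode F v d k C ∧ C.card = n} := by
    have := Fintype.ofFinite (Submodule F (Fin v → F))
    refine ⟨Fintype.card (Submodule F (Fin v → F)), ?_⟩
    rintro n ⟨C, -, rfl⟩
    exact C.card_le_univ
  have hne : {n : ℕ | ∃ C : Finset (Submodule F (Fin v → F)),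
      IsConstDimCode F v d k C ∧ C.card = n}.Nonempty :=
    ⟨0, ∅, ⟨by simp, by simp⟩, by simp⟩
  exact ⟨Nat.sSup_mem hne hb, fun n hn => le_csSup hb hn⟩

/-! Codes with distance `2k` are partial spreads. The lower bound iterates a lifting: the graphs of
multiplication by elements of a degree-`m` extension add `q^m` members when `k` dimensions are added
(`exists_add`).

For the upper bound, one extra member would leave `1 + q^k * (q^r - 2)` holes, i.e. uncovered
nonzero vectors. Passing to a hyperplane with fewer holes than average, `k - 1` times, keeps the
count of the form `1 + q^(k-j) * x`, and each step lowers `x` by at least `q - 1`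
(`exists_card_holes_le`). If `k - 1` is at least `(q^r - 1)/(q - 1)`, the final `x` is negative and
so is the number of holes, which is absurd. -/

/-- `f` is a family of pairwise trivially intersecting subspaces of dimension `k`. -/
def IsPartialSpread {F V ι : Type*} [Field F] [AddCommGroup V] [Module F V] (k : ℕ)
    (f : ι → Submodule F V) : Prop :=
  (∀ i, Module.finrank F (f i) = k) ∧ Pairwise fun i j => Disjoint (f i) (f j)

/-! ### Construction of large partial spreads -/

namespace IsPartialSpread

variable {F V W ι : Type*} [Field F] [AddCommGroup V] [Module F V] [AddCommGroup W] [Module F W]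
  {k : ℕ}

theorem map {f : ι → Submodule F V} (h : IsPartialSpread k f) (e : V →ₗ[F] W)
    (he : Function.Injective e) : IsPartialSpread k fun i => (f i).map e :=
  ⟨fun i => (Submodule.equivMapOfInjective e he (f i)).finrank_eq.symm.trans (h.1 i),
    fun _ _ hij => (Submodule.disjoint_map he (h.2 hij))⟩

/-- Positivity of `k` is essential: the zero subspace is disjoint from itself. -/
theorem injective {f : ι → Submodule F V} (h : IsPartialSpread k f) (hk : 0 < k) :
    Function.Injective f := by
  intro i j hij
  by_contra hne
  have hd : Disjoint (f i) (f j) := h.2 hne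
  rw [← hij, disjoint_self] at hd
  have := h.1 i
  rw [hd, finrank_bot] at this
  omega

/-- Multiplication by the elements of a field extension `K` yields `K`-many graphs which extend a
partial spread of `K` to one of `U × K`. -/
theorem sumElim_graph {K U : Type*} [Field K] [Algebra F K] [AddCommGroup U] [Module F U]
    (u : U →ₗ[F] K) (hu : Function.Injective u) (hU : Module.finrank F U = k)
    {f : ι → Submodule F K} (h : IsPartialSpread k f) :
    IsPartialSpread k (Sum.elim (fun a : K => (LinearMap.mulLeft F a ∘ₗ u).graph)
      (fun i => (f i).map (LinearMap.inr F U K))) := by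
  have hf := h.map (LinearMap.inr F U K) LinearMap.inr_injective
  have hgf : ∀ (a : K) (i : ι), Disjoint (LinearMap.mulLeft F a ∘ₗ u).graph
      ((f i).map (LinearMap.inr F U K)) := by
    intro a i
    rw [Submodule.disjoint_def]
    rintro ⟨x, y⟩ hx hy
    obtain ⟨z, -, hz⟩ := hy
    obtain ⟨rfl, rfl⟩ := Prod.ext_iff.1 hz
    simpa using hx
  refine ⟨?_, ?_⟩
  · rintro (a | i)
    · have : Function.Injective (LinearMap.id.prod (LinearMap.mulLeft F a ∘ₗ u)) :=
        fun x y hxy => (Prod.ext_iff.1 hxy).1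
      change Module.finrank F (LinearMap.mulLeft F a ∘ₗ u).graph = k
      rw [LinearMap.graph_eq_range_prod, LinearMap.finrank_range_of_inj this, hU]
    · exact hf.1 i
  · rintro (a | i) (b | j) hij
    · have hab : a - b ≠ 0 := sub_ne_zero.2 fun hab => hij (congrArg Sum.inl hab)
      simp only [Sum.elim_inl]
      rw [Submodule.disjoint_def]
      rintro ⟨x, y⟩ hx hy
      simp only [LinearMap.mem_graph_iff, LinearMap.comp_apply, LinearMap.mulLeft_apply] at hx hy
      -- Distinct multipliers differ by a unit of the field `K`, so the two graphs agree only over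
      -- `ker u`.
      have hx0 : u x = 0 := by
        have : (a - b) * u x = 0 := by rw [sub_mul, ← hx, ← hy, sub_self]
        exact (mul_eq_zero.1 this).resolve_left hab
      have : x = 0 := hu (by rw [hx0, map_zero])
      rw [hx0, mul_zero] at hx
      simp [hx, this]
    · exact hgf a j
    · exact (hgf b i).symm
    · exact hf.2 fun hh => hij (congrArg Sum.inr hh)

variable (F) in
/-- A partial spread of `F^m` with `N` members extends to one of `F^(k+m)` with `q^m + N`
members. -/
theorem exists_add [Finite F] {m N : ℕ} (hk : 0 < k) (hkm : k ≤ m)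
    (h : ∃ f : Fin N → Submodule F (Fin m → F), IsPartialSpread k f) :
    ∃ f : Fin (Nat.card F ^ m + N) → Submodule F (Fin (k + m) → F), IsPartialSpread k f := by
  obtain ⟨f, hf⟩ := h
  obtain ⟨p, hp⟩ := CharP.exists F
  have : Fact p.Prime := ⟨CharP.char_is_prime F p⟩
  have : NeZero m := ⟨by omega⟩
  let K := FiniteField.Extension F p m
  have hK : Module.finrank F K = m := FiniteField.finrank_extension F p m
  have : Finite K := inferInstanceAs (Finite (FiniteField.Extension F p m))
  have := Fintype.ofFinite K
  let e : (Fin m → F) ≃ₗ[F] K := LinearEquiv.ofFinrankEq _ _ (by rw [hK, Module.finrank_fin_fun])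
  obtain ⟨u, hu⟩ : ∃ u : (Fin k → F) →ₗ[F] K, Function.Injective u :=
    finrank_le_iff_exists_linearMap.1 (by simpa [hK] using hkm)
  let e' : ((Fin k → F) × K) ≃ₗ[F] (Fin (k + m) → F) :=
    LinearEquiv.ofFinrankEq _ _ (by simp [hK])
  have hs := ((hf.map e.toLinearMap e.injective).sumElim_graph u hu (by simp)).map
    e'.toLinearMap e'.injective
  have hc : Fintype.card (K ⊕ Fin N) = Fintype.card (Fin (Nat.card F ^ m + N)) := by
    rw [Fintype.card_sum, Fintype.card_fin, Fintype.card_fin, Fintype.card_eq_nat_card]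
    congr 1
    exact FiniteField.natCard_extension F p m
  let σ := (Fintype.equivOfCardEq hc).symm
  exact ⟨_, fun i => hs.1 (σ i), fun i j hij => hs.2 (σ.injective.ne hij)⟩

-- Starting from one subspace of `F^(k+r)`, each lifting contributes the next term `q^((s+1)k+r)` of
-- the geometric sum.
variable (F) in
theorem exists_sum [Finite F] {r : ℕ} (hk : 0 < k) (s : ℕ) :
    ∃ f : Fin (Nat.card F ^ (k + r) * ∑ i ∈ Finset.range s, (Nat.card F ^ k) ^ i + 1) →
      Submodule F (Fin ((s + 1) * k + r) → F), IsPartialSpread k f := by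
  induction s with
  | zero =>
    obtain ⟨u, hu⟩ : ∃ u : (Fin k → F) →ₗ[F] (Fin ((0 + 1) * k + r) → F),
      Function.Injective u := finrank_le_iff_exists_linearMap.1 (by simp)
    refine ⟨fun _ => LinearMap.range u, fun _ => ?_, fun i j hij => ?_⟩
    · rw [LinearMap.finrank_range_of_inj hu, Module.finrank_fin_fun]
    · have := i.2
      have := j.2
      simp only [Finset.range_zero, Finset.sum_empty, mul_zero, zero_add] at *
      omega
  | succ s ih =>
    have h := exists_add F hk (by nlinarith) ih
    have h1 : k + ((s + 1) * k + r) = (s + 1 + 1) * k + r := by ring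
    have h2 : Nat.card F ^ ((s + 1) * k + r) +
        (Nat.card F ^ (k + r) * ∑ i ∈ Finset.range s, (Nat.card F ^ k) ^ i + 1) =
        Nat.card F ^ (k + r) * ∑ i ∈ Finset.range (s + 1), (Nat.card F ^ k) ^ i + 1 := by
      rw [Finset.sum_range_succ]
      ring
    rwa [h1, h2] at h

end IsPartialSpread

/-! ### Averaging over hyperplanes -/

/-- A nonzero vector is annihilated by the fraction `1/q` of all linear functionals. -/
theorem card_mul_card_dual_apply_eq_zero {F V : Type*} [Field F] [AddCommGroup V]
    [Module F V] {s : V} (hs : s ≠ 0) :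
    Nat.card F * Nat.card {f : Module.Dual F V // f s = 0} = Nat.card (Module.Dual F V) := by
  obtain ⟨g, hg⟩ := Module.Projective.exists_dual_ne_zero F hs
  have hev : Function.Surjective (Module.Dual.eval F V s) :=
    LinearMap.surjective fun hh => hg (LinearMap.congr_fun hh g)
  have h1 := Submodule.card_eq_card_quotient_mul_card (LinearMap.ker (Module.Dual.eval F V s))
  rw [Nat.card_congr ((Module.Dual.eval F V s).quotKerEquivOfSurjective hev).toEquiv] at h1
  rw [h1, mul_comm]
  rfl

open scoped Classical in
/-- A nonempty set of nonzero vectors is met by some hyperplane in less than the fraction `1/q` of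
its members. -/
theorem exists_dual_card_filter_lt {F V : Type*} [Field F] [Finite F] [AddCommGroup V]
    [Module F V] [FiniteDimensional F V] (S : Finset V) (hS : S.Nonempty) (h0 : (0 : V) ∉ S) :
    ∃ f : Module.Dual F V, Nat.card F * (S.filter fun s => f s = 0).card < S.card := by
  have : Finite (Module.Dual F V) := Module.finite_of_finite F
  have := Fintype.ofFinite (Module.Dual F V)
  by_contra! h
  have hlt : ∑ _f : Module.Dual F V, S.card <
      ∑ f : Module.Dual F V, Nat.card F * (S.filter fun s => f s = 0).card := by
    -- Strictness comes from the zero functional, which kills all of `S`; double counting shows that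
    -- the two sums are equal.
    refine Finset.sum_lt_sum (fun f _ => h f) ⟨0, Finset.mem_univ _, ?_⟩
    rw [Finset.filter_true_of_mem fun s _ => LinearMap.zero_apply s]
    exact lt_mul_of_one_lt_left hS.card_pos Finite.one_lt_card
  have heq : ∀ s ∈ S, Nat.card F * (Finset.univ.filter fun f : Module.Dual F V => f s = 0).card =
      Nat.card (Module.Dual F V) := fun s hs => by
    rw [← card_mul_card_dual_apply_eq_zero fun hh : s = 0 => h0 (hh ▸ hs),
      ← Fintype.card_subtype, Nat.card_eq_fintype_card (α := {f : Module.Dual F V // f s = 0})]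
  have hsum : ∑ f : Module.Dual F V, (S.filter fun s => f s = 0).card =
      ∑ s ∈ S, (Finset.univ.filter fun f : Module.Dual F V => f s = 0).card := by
    simp only [Finset.card_filter]
    exact Finset.sum_comm
  rw [← Finset.mul_sum, hsum, Finset.mul_sum, Finset.sum_congr rfl heq, Finset.sum_const,
    Finset.sum_const, Finset.card_univ, smul_eq_mul, smul_eq_mul, Nat.card_eq_fintype_card,
    mul_comm] at hlt
  exact lt_irrefl _ hlt

/-! ### Counting holes -/

open scoped Classical in
/-- The nonzero vectors of `W` which are in no member of the family `X`. -/
noncomputable def holes {F V ι : Type*} [Field F] [AddCommGroup V] [Module F V] [Fintype V]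
    (X : ι → Submodule F V) (W : Submodule F V) : Finset V :=
  Finset.univ.filter fun x => x ∈ W ∧ x ≠ 0 ∧ ∀ i, x ∉ X i

theorem card_filter_mem_ne_zero {F V : Type*} [Field F] [AddCommGroup V] [Module F V]
    [Fintype V] [DecidableEq V] (W : Submodule F V) [DecidablePred (· ∈ W)] :
    (Finset.univ.filter fun x => x ∈ W ∧ x ≠ 0).card + 1 =
      Nat.card F ^ Module.finrank F W := by
  rw [← Module.natCard_eq_pow_finrank (K := F) (V := W), Nat.card_eq_fintype_card,
    Fintype.card_subtype, ← Finset.filter_filter, Finset.filter_ne',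
    Finset.card_erase_add_one (by simp)]

-- The holes and the nonzero vectors of the `X i ⊓ W` partition the nonzero vectors of `W`.
open scoped Classical in
theorem card_holes {F V ι : Type*} [Field F] [AddCommGroup V] [Module F V] [Fintype V]
    [Fintype ι] {k : ℕ} {X : ι → Submodule F V} (hX : IsPartialSpread k X) (W : Submodule F V) :
    ((holes X W).card : ℤ) = (Nat.card F ^ Module.finrank F W - 1) -
      ∑ i, ((Nat.card F : ℤ) ^ Module.finrank F ↥(X i ⊓ W) - 1) := by
  have hc : ∀ U : Submodule F V, (Nat.card F : ℤ) ^ Module.finrank F U - 1 =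
      (Finset.univ.filter fun x => x ∈ U ∧ x ≠ 0).card := fun U => by
    have := card_filter_mem_ne_zero U
    rw [sub_eq_iff_eq_add]
    exact_mod_cast this.symm
  simp only [hc]
  have hd : (Finset.univ.filter fun x => x ∈ W ∧ x ≠ 0) = (holes X W) ∪
      Finset.univ.biUnion fun i => Finset.univ.filter fun x => x ∈ X i ⊓ W ∧ x ≠ 0 := by
    ext x
    simp only [holes, Finset.mem_filter, Finset.mem_univ, true_and, Finset.mem_union,
      Finset.mem_biUnion, Submodule.mem_inf]
    by_cases h : ∃ i, x ∈ X i
    · obtain ⟨i, hi⟩ := h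
      grind
    · grind
  rw [hd, Finset.card_union_of_disjoint, Finset.card_biUnion]
  · push_cast
    ring
  · intro i _ j _ hij
    refine Finset.disjoint_left.2 fun x hx hy => ?_
    simp only [Finset.mem_filter, Submodule.mem_inf] at hx hy
    exact hx.2.2 (Submodule.disjoint_def.1 (hX.2 hij) x hx.2.1.1 hy.2.1.1)
  · rw [Finset.disjoint_left]
    intro x hx hy
    simp only [holes, Finset.mem_filter, Finset.mem_univ, true_and, Finset.mem_biUnion,
      Submodule.mem_inf] at hx hy
    obtain ⟨i, hi⟩ := hy
    exact hx.2.2 i hi.1.1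

theorem finrank_le_finrank_inf_ker_add_one {F V : Type*} [Field F] [AddCommGroup V] [Module F V]
    [FiniteDimensional F V] (W : Submodule F V) (f : Module.Dual F V) :
    Module.finrank F W ≤ Module.finrank F ↥(W ⊓ LinearMap.ker f) + 1 := by
  have h1 := Submodule.finrank_sup_add_finrank_inf_eq W (LinearMap.ker f)
  have h2 := f.finrank_range_add_finrank_ker
  have h3 := Submodule.finrank_le (W ⊔ LinearMap.ker f)
  have h4 := (LinearMap.range f).finrank_le
  rw [Module.finrank_self] at h4
  omega

theorem finrank_le_finrank_inf_add {F V : Type*} [Field F] [AddCommGroup V] [Module F V]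
    [FiniteDimensional F V] (X W : Submodule F V) {j : ℕ}
    (hW : Module.finrank F V ≤ Module.finrank F W + j) :
    Module.finrank F X ≤ Module.finrank F ↥(X ⊓ W) + j := by
  have h1 := Submodule.finrank_sup_add_finrank_inf_eq X W
  have h3 := Submodule.finrank_le (X ⊔ W)
  omega

/-! ### Descent and the upper bound -/

open scoped Classical in
/-- Descent through subspaces: in codimension at most `j` there is a subspace with few holes. -/
theorem exists_card_holes_le {F V ι : Type*} [Field F] [Finite F] [AddCommGroup V] [Module F V]
    [Fintype V] [Fintype ι] {k : ℕ} {X : ι → Submodule F V} (hX : IsPartialSpread k X)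
    (hkV : k ≤ Module.finrank F V) (hι : (Nat.card F : ℤ) ^ k ∣ Fintype.card ι - 2) {x₀ : ℤ}
    (hx₀ : ((holes X ⊤).card : ℤ) = 1 + (Nat.card F : ℤ) ^ k * x₀) (j : ℕ) (hj : j < k) :
    ∃ (W : Submodule F V) (x : ℤ), Module.finrank F V ≤ Module.finrank F W + j ∧
      ((holes X W).card : ℤ) = 1 + (Nat.card F : ℤ) ^ (k - j) * x ∧
        x ≤ x₀ - j * (Nat.card F - 1) := by
  have hq : 1 < Nat.card F := Finite.one_lt_card
  have hcop : ∀ n, IsCoprime ((Nat.card F : ℤ) - 1) ((Nat.card F : ℤ) ^ n) := fun n =>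
    IsCoprime.pow_right ⟨-1, 1, by ring⟩
  generalize hQ : Nat.card F = q at *
  have hdvd : ∀ W : Submodule F V, (q : ℤ) - 1 ∣ (holes X W).card := fun W => by
    rw [card_holes hX W, hQ]
    exact dvd_sub (sub_one_dvd_pow_sub_one _ _)
      (Finset.dvd_sum fun i _ => sub_one_dvd_pow_sub_one _ _)
  induction j with
  | zero => exact ⟨⊤, x₀, by simp, by simpa using hx₀, by simp⟩
  | succ j ih =>
    obtain ⟨W, x, hW, hcard, hx⟩ := ih (by omega)
    -- Since `j < k`, the count is `1` modulo `q`, hence nonzero.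
    have hne : (holes X W).Nonempty := by
      rw [Finset.nonempty_iff_ne_empty]
      intro he
      rw [he, Finset.card_empty] at hcard
      have h1 : (q : ℤ) ∣ 1 := by
        have : (q : ℤ) ∣ (q : ℤ) ^ (k - j) * x :=
          (dvd_pow_self _ (by omega)).mul_right _
        have h2 : (1 : ℤ) = -((q : ℤ) ^ (k - j) * x) := by push_cast at hcard; linarith
        rw [h2]
        exact this.neg_right
      have := Int.le_of_dvd one_pos h1
      omega
    obtain ⟨f, hf⟩ := exists_dual_card_filter_lt (F := F) (holes X W) hne (by simp [holes])
    have hfil : (holes X W).filter (fun s => f s = 0) = holes X (W ⊓ LinearMap.ker f) := by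
      ext s
      simp only [holes, Finset.mem_filter, Submodule.mem_inf, LinearMap.mem_ker]
      tauto
    rw [hfil, hQ] at hf
    have hW' : Module.finrank F V ≤ Module.finrank F ↥(W ⊓ LinearMap.ker f) + (j + 1) := by
      have := finrank_le_finrank_inf_ker_add_one W f
      omega
    set W' := W ⊓ LinearMap.ker f
    -- `W'` and every `X i ⊓ W'` have dimension at least `k - (j + 1)`; the leftover constant is
    -- `Fintype.card ι - 2`, divisible by `hι`.
    have hmod : (q : ℤ) ^ (k - (j + 1)) ∣ (holes X W').card - 1 := by
      have : ((holes X W').card : ℤ) - 1 = (q : ℤ) ^ Module.finrank F W' -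
          ∑ i, (q : ℤ) ^ Module.finrank F ↥(X i ⊓ W') + (Fintype.card ι - 2) := by
        rw [card_holes hX W', hQ]
        simp
        ring
      rw [this]
      refine dvd_add (dvd_sub (pow_dvd_pow _ (by omega)) (Finset.dvd_sum fun i _ =>
        pow_dvd_pow _ ?_)) ((pow_dvd_pow _ (by omega)).trans hι)
      have := finrank_le_finrank_inf_add (X i) W' hW'
      rw [hX.1 i] at this
      omega
    obtain ⟨y, hy⟩ := hmod
    refine ⟨W', y, hW', by linarith, ?_⟩
    have hpow : (q : ℤ) ^ (k - j) = q * q ^ (k - (j + 1)) := by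
      rw [← pow_succ']
      congr 1
      omega
    have hpos : 0 < (q : ℤ) ^ (k - j) := by positivity
    have hlt : y < x := by
      have hf' : (q : ℤ) * (holes X W').card < (holes X W).card := by exact_mod_cast hf
      have hq' : (1 : ℤ) < q := by exact_mod_cast hq
      have h3 : (q : ℤ) ^ (k - j) * y < (q : ℤ) ^ (k - j) * x := by
        have : (holes X W').card = 1 + (q : ℤ) ^ (k - (j + 1)) * y := by linarith
        rw [this, hcard, mul_add, ← mul_assoc, ← hpow] at hf'
        linarith
      exact lt_of_mul_lt_mul_left h3 hpos.le
    -- Both hole counts are multiples of `q - 1`, which is coprime to `q`; this sharpens `y < x` to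
    -- a drop of at least `q - 1`.
    have hd : (q : ℤ) - 1 ∣ x - y := by
      have h1 : (q : ℤ) - 1 ∣ (q : ℤ) ^ (k - (j + 1)) * (x - y) := by
        have : (q : ℤ) ^ (k - (j + 1)) * (x - y) = (holes X W).card - (holes X W').card -
            (q - 1) * ((q : ℤ) ^ (k - (j + 1)) * x) := by
          rw [hcard, hpow]
          linear_combination hy
        rw [this]
        exact dvd_sub (dvd_sub (hdvd W) (hdvd W')) (dvd_mul_right _ _)
      exact (hcop _).dvd_of_dvd_mul_left h1
    have := Int.le_of_dvd (by linarith) hd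
    push_cast
    linarith

/-- A partial spread of `F^(tk+r)` does not have one member more than the lifted construction. -/
theorem IsPartialSpread.sub_one_mul_lt {F V ι : Type*} [Field F] [Finite F]
    [AddCommGroup V] [Module F V] [FiniteDimensional F V] [Fintype ι] {k r s : ℕ} {X : ι → Submodule F V}
    (hX : IsPartialSpread k X) (hk : 0 < k) (hV : Module.finrank F V = (s + 1) * k + r)
    (hι : Fintype.card ι =
      Nat.card F ^ (k + r) * ∑ i ∈ Finset.range s, (Nat.card F ^ k) ^ i + 2) :
    ((k : ℤ) - 1) * (Nat.card F - 1) < Nat.card F ^ r - 1 := by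
  have : Finite V := Module.finite_of_finite F
  have := Fintype.ofFinite V
  have hq : 1 < Nat.card F := Finite.one_lt_card
  have htop : ((holes X ⊤).card : ℤ) =
      1 + (Nat.card F : ℤ) ^ k * ((Nat.card F : ℤ) ^ r - 2) := by
    have hg := geom_sum_mul ((Nat.card F : ℤ) ^ k) s
    have hXk : ∀ i, Module.finrank F ↥(X i ⊓ ⊤) = k := fun i => by rw [inf_top_eq, hX.1]
    simp only [card_holes hX, hXk, finrank_top, hV, Finset.sum_const, Finset.card_univ, hι,
      nsmul_eq_mul]
    push_cast
    generalize (Nat.card F : ℤ) = q at *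
    have : q ^ ((s + 1) * k + r) = q ^ (k + r) * (q ^ k) ^ s := by ring
    rw [this, ← sub_add_cancel ((q ^ k) ^ s) 1, ← hg]
    ring
  obtain ⟨W, x, -, hc, hx⟩ := exists_card_holes_le hX (by rw [hV]; nlinarith)
    (by
      rw [hι]
      push_cast
      rw [add_sub_cancel_right, pow_add, mul_assoc]
      exact dvd_mul_right _ _) htop (k - 1) (by omega)
  have hq' : (1 : ℤ) < Nat.card F := by exact_mod_cast hq
  -- In codimension at most `k - 1` the count is `1 + q * x`, negative as soon as `x ≤ -1`.
  have hx0 : 0 ≤ x := by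
    by_contra! hneg
    have : k - (k - 1) = 1 := by omega
    rw [this, pow_one] at hc
    have := Int.natCast_nonneg (holes X W).card
    nlinarith
  rw [Nat.cast_sub (by omega)] at hx
  push_cast at hx
  linarith

/-! ### Codes versus partial spreads, and the conclusion -/

/-- The members of a code with subspace distance `2k` form a partial spread. -/
theorem IsConstDimCode.isPartialSpread {F : Type*} [Field F] {v k : ℕ}
    {C : Finset (Submodule F (Fin v → F))} (hC : IsConstDimCode F v (2 * k) k C) :
    IsPartialSpread k fun X : C => (X : Submodule F (Fin v → F)) := by
  refine ⟨fun X => hC.1 X X.2, fun X Y hXY => ?_⟩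
  have h1 := hC.2 X X.2 Y Y.2 (Subtype.coe_ne_coe.2 hXY)
  have h2 := Submodule.finrank_sup_add_finrank_inf_eq (X : Submodule F (Fin v → F)) Y
  rw [hC.1 X X.2, hC.1 Y Y.2] at h2
  rw [subspaceDist] at h1
  change Disjoint (X : Submodule F (Fin v → F)) Y
  rw [disjoint_iff, ← Submodule.finrank_eq_zero (R := F)]
  omega

/-- The members of a partial spread form a code with subspace distance `2k`. -/
theorem IsPartialSpread.exists_isConstDimCode {F ι : Type*} [Field F] [Fintype ι] {v k : ℕ}
    {f : ι → Submodule F (Fin v → F)} (hf : IsPartialSpread k f) (hk : 0 < k) :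
    ∃ C, IsConstDimCode F v (2 * k) k C ∧ C.card = Fintype.card ι := by
  refine ⟨Finset.univ.map ⟨f, hf.injective hk⟩, ⟨?_, ?_⟩, by simp⟩
  · simpa using hf.1
  · simp only [Finset.mem_map, Finset.mem_univ, true_and, Function.Embedding.coeFn_mk]
    rintro _ ⟨i, rfl⟩ _ ⟨j, rfl⟩ hij
    have hd : Disjoint (f i) (f j) := hf.2 fun hh => hij (congrArg f hh)
    have h2 := Submodule.finrank_sup_add_finrank_inf_eq (f i) (f j)
    rw [hf.1, hf.1] at h2
    rw [subspaceDist]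
    rw [hd.eq_bot, finrank_bot] at h2 ⊢
    omega

theorem maxCodeSize_eq {F : Type*} [Field F] [Finite F] {k r s : ℕ} (hk : 0 < k)
    (hr : (Nat.card F : ℤ) ^ r - 1 ≤ (k - 1) * (Nat.card F - 1)) :
    maxCodeSize F ((s + 1) * k + r) (2 * k) k =
      Nat.card F ^ (k + r) * ∑ i ∈ Finset.range s, (Nat.card F ^ k) ^ i + 1 := by
  have hmax := isGreatest_maxCodeSize F ((s + 1) * k + r) (2 * k) k
  refine le_antisymm ?_ ?_
  · by_contra! hlt
    obtain ⟨C, hC, hcard⟩ := hmax.1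
    -- The code is cut down to exactly one member too many, the size for which the holes were
    -- counted.
    obtain ⟨D, hDC, hD⟩ := Finset.exists_subset_card_eq (hcard ▸ Nat.succ_le_of_lt hlt)
    have hDcode : IsConstDimCode F ((s + 1) * k + r) (2 * k) k D :=
      ⟨fun X hX => hC.1 X (hDC hX), fun X hX Y hY => hC.2 X (hDC hX) Y (hDC hY)⟩
    exact hr.not_gt (hDcode.isPartialSpread.sub_one_mul_lt hk (Module.finrank_fin_fun F) (by simpa using hD))
  · obtain ⟨f, hf⟩ := IsPartialSpread.exists_sum F (r := r) hk s
    obtain ⟨C, hC, hcard⟩ := hf.exists_isConstDimCode hk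
    exact hmax.2 ⟨C, hC, by rw [hcard, Fintype.card_fin]⟩

theorem gaussBinom_one_right {q r : ℕ} (hr : 1 ≤ r) :
    gaussBinom q r 1 = ((q : ℚ) ^ r - 1) / (q - 1) := by
  simp [gaussBinom, hr]

theorem mainTheorem3 (F : Type*) [Field F] [Finite F] (q : ℕ) (hq : Nat.card F = q)
    (v t k r : ℕ) (hv : v = t * k + r) (hr1 : 1 ≤ r) (hrk : r < k) (ht : 2 ≤ t)
    (hk : gaussBinom q r 1 < (k : ℚ)) :
    (maxCodeSize F v (2 * k) k : ℚ) =
      ((q : ℚ) ^ v - (q : ℚ) ^ (k + r)) / ((q : ℚ) ^ k - 1) + 1 := by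
  obtain ⟨s, rfl⟩ : ∃ s, t = s + 1 := ⟨t - 1, by omega⟩
  have hq1 : 1 < q := hq ▸ Finite.one_lt_card
  have hqQ : (1 : ℚ) < q := by exact_mod_cast hq1
  have hqZ : (1 : ℤ) < q := by exact_mod_cast hq1
  have hgeom : ((q : ℤ) - 1) * ∑ i ∈ Finset.range r, (q : ℤ) ^ i = (q : ℤ) ^ r - 1 :=
    mul_geom_sum _ _
  have hlt : ∑ i ∈ Finset.range r, (q : ℤ) ^ i < k := by
    rw [gaussBinom_one_right hr1, ← geom_sum_eq hqQ.ne'] at hk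
    exact_mod_cast hk
  -- The Gaussian coefficient is an integer below `k`, hence at most `k - 1`.
  have hr : (Nat.card F : ℤ) ^ r - 1 ≤ (k - 1) * (Nat.card F - 1) := by
    rw [hq, ← hgeom, mul_comm]
    exact mul_le_mul_of_nonneg_right (by omega) (by omega)
  rw [hv, maxCodeSize_eq (by omega) hr, hq]
  push_cast
  have hqk : (q : ℚ) ^ k ≠ 1 := (one_lt_pow₀ hqQ (by omega)).ne'
  rw [geom_sum_eq hqk]
  ring
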